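/- **Theorem 2.1 (Convergence and synchronization).** Let $N\ge 1$, let $\mathbf A=(\alpha_{ij})_{i,j=1}^N$ be a stochastic matrix (nonnegative entries, rows summing to $1$), and let $(r_n)_{n\ge 0}$ be a sequence in $(0,1)$ with $\sum_n r_n=+\infty$ and $\sum_n r_n^2<+\infty$. On a probability space with a filtration $(\mathcal F_n)_{n\ge 0}$, let $\mathbf Z_0$ be an $\mathcal F_0$-measurable initial state with values in $[0,1]^N$, let $\mathbf Y_n=(Y_n(i))_{i=1}^N$, $n\ge 1$, be $\mathcal F_n$-measurable with values in $\{0,1\}^N$, and suppose that for all $n\ge 0$ and $i=1,\dots,N$ $$Z_{n+1}(i)=(1-r_n)Z_n(i)+r_nY_{n+1}(i),\qquad P\big(Y_{n+1}(i)=1\mid\mathcal F_n\big)=\alpha_{ii}Z_n(i)+\sum_{j\ne i}\alpha_{ij}\big(1-Z_n(j)\big)\quad\text{a.s.}$$ (For instance, $\mathbf Z_0$ is deterministic and $\mathcal F_n=\sigma(\mathbf Y_k;\,1\le k\le n)$.) Let $G$ be the oriented graph on $\{1,\dots,N\}$ with an edge $(i,j)$ if and only if $i\ne j$ and $\alpha_{ij}\ne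 0$. Call $G$ irreducible if for any two distinct vertices there are oriented paths from each to the other, and bipartite, with parts $I,J$, if $\{1,\dots,N\}$ is the disjoint union of $I$ and $J$ and no edge joins two vertices of the same part (a part may be empty, so that a graph with a single vertex is bipartite). If $G$ is irreducible, then $\mathbf Z_n=(Z_n(i))_{i=1}^N$ converges almost surely to a random vector $\mathbf Z_\infty=(Z_\infty(i))_{i=1}^N$. Moreover: 1. If $G$ is bipartite with parts $I,J$, then there is a random variable $Z_\infty$ such that, almost surely, $Z_\infty(i)=Z_\infty$ for every $i\in I$ and $Z_\infty(i)=1-Z_\infty$ for every $i\in J$. If in addition, for every $n\ge 0$, the variables $Y_{n+1}(1),\dots,Y_{n+1}(N)$ are conditionally independent given $\mathcal F_n$, and $\mathbf Z_0$ is neither almost surely equal to $\mathbf 1_I$ nor almost surely equal to $\mathbf 1_J$ (the indicator vectors of $I$ and of $J$), then $P(Z_\infty=x)<1$ for every $x$. 2. If $G$ is not bipartite, then $\mathbf Z_\infty=\tfrac12\mathbf 1$ almost surely, where $\mathbf 1$ is the vector of ones. -/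

import Mathlib

open MeasureTheory ProbabilityTheory Filter Topology

namespace Competitive

/-- The oriented interaction graph of the weight matrix `A`: there is an edge `(i, j)` if and only
if `i ≠ j` and `A i j ≠ 0`. -/
def interactionGraph {N : ℕ} (A : Matrix (Fin N) (Fin N) ℝ) : Digraph (Fin N) where
  Adj i j := i ≠ j ∧ A i j ≠ 0

/-- There is an oriented path (of length at least one) from `i` to `j`. -/
def Accessible {N : ℕ} (G : Digraph (Fin N)) (i j : Fin N) : Prop :=
  Relation.TransGen G.Adj i j

/-- `i` and `j` communicate: there are oriented paths in both directions. -/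
def Communicate {N : ℕ} (G : Digraph (Fin N)) (i j : Fin N) : Prop :=
  Accessible G i j ∧ Accessible G j i

/-- Every pair of (distinct) vertices communicates. -/
def IsIrreducible {N : ℕ} (G : Digraph (Fin N)) : Prop :=
  ∀ i j, i ≠ j → Communicate G i j

/-- `I`, `J` partition the vertex set and every edge joins `I` to `J` (in either orientation).
For an irreducible graph with at least two vertices both parts are then nonempty;
a graph with a single vertex counts as bipartite. -/
def IsBipartition {N : ℕ} (G : Digraph (Fin N)) (I J : Set (Fin N)) : Prop :=
  IsCompl I J ∧ ∀ i j, G.Adj i j → (i ∈ I ∧ j ∈ J) ∨ (i ∈ J ∧ j ∈ I)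

def IsBipartite {N : ℕ} (G : Digraph (Fin N)) : Prop :=
  ∃ I J : Set (Fin N), IsBipartition G I J

/-- Step sizes `r n ∈ (0, 1)` with divergent sum and convergent sum of squares. -/
structure IsStepSequence (r : ℕ → ℝ) : Prop where
  mem_Ioo : ∀ n, r n ∈ Set.Ioo (0 : ℝ) 1
  sum_eq_top : Tendsto (fun n => ∑ k ∈ Finset.range n, r k) atTop atTop
  sum_sq_lt_top : Summable fun n => r n ^ 2

/-- The competitive interacting reinforced dynamics with weights `A` and steps `r`, on a
probability space with a filtration `ℱ`: the states `Z n ω i ∈ [0, 1]` are driven by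
the `{0, 1}`-valued noise `Y (n + 1) ω i`, and given the past `ℱ n` the probability of
`Y (n + 1) i = 1` is `A i i * Z n i + ∑ j ≠ i, A i j * (1 - Z n j)`. The filtration may be the one
generated by the noise (and by `Z 0`, if random) or a larger one. The value `Y 0` plays no role. -/
structure IsCompetitiveSystem {Ω : Type*} {mΩ : MeasurableSpace Ω} (μ : Measure Ω)
    (ℱ : Filtration ℕ mΩ) {N : ℕ} (A : Matrix (Fin N) (Fin N) ℝ) (r : ℕ → ℝ)
    (Z Y : ℕ → Ω → Fin N → ℝ) : Prop where
  measurable_init : Measurable[ℱ 0] (Z 0)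
  init_mem : ∀ ω i, Z 0 ω i ∈ Set.Icc (0 : ℝ) 1
  measurable_noise : ∀ n, Measurable[ℱ (n + 1)] (Y (n + 1))
  noise_mem : ∀ n ω i, Y (n + 1) ω i = 0 ∨ Y (n + 1) ω i = 1
  step : ∀ n ω i, Z (n + 1) ω i = (1 - r n) * Z n ω i + r n * Y (n + 1) ω i
  condProb : ∀ n i, μ⟦{ω | Y (n + 1) ω i = 1} | ℱ n⟧ =ᵐ[μ] fun ω =>
    A i i * Z n ω i + ∑ j ∈ Finset.univ.erase i, A i j * (1 - Z n ω j)

/-- For every `n`, the agents' actions `Y (n + 1) i`, `i = 1, …, N`, are conditionally independent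
given `ℱ n` (for discrete variables: conditional joint probabilities factorize). -/
def CondIndepNoise {Ω : Type*} {mΩ : MeasurableSpace Ω} (μ : Measure Ω)
    (ℱ : Filtration ℕ mΩ) {N : ℕ} (Y : ℕ → Ω → Fin N → ℝ) : Prop :=
  ∀ (n : ℕ) (y : Fin N → ℝ),
    μ⟦{ω | ∀ i, Y (n + 1) ω i = y i} | ℱ n⟧ =ᵐ[μ] fun ω =>
      ∏ i, (μ⟦{ω' | Y (n + 1) ω' i = y i} | ℱ n⟧) ω

/-- The initial state is not almost surely equal to the configuration `1` on `I` and `0` on `J`,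
nor almost surely equal to the configuration `0` on `I` and `1` on `J`. These are the two
configurations in which the dynamics is frozen. -/
def NotFrozenAtStart {Ω : Type*} {mΩ : MeasurableSpace Ω} (μ : Measure Ω) {N : ℕ}
    (I J : Set (Fin N)) (Z₀ : Ω → Fin N → ℝ) : Prop :=
  ¬ (∀ᵐ ω ∂μ, (∀ i ∈ I, Z₀ ω i = 1) ∧ (∀ i ∈ J, Z₀ ω i = 0)) ∧
  ¬ (∀ᵐ ω ∂μ, (∀ i ∈ I, Z₀ ω i = 0) ∧ (∀ i ∈ J, Z₀ ω i = 1))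

end Competitive

namespace Competitive

/-! ### Linear algebra of the weights: stationary vector, Dirichlet form, equality cases -/

section WeightMatrix

variable {N : ℕ} {A : Matrix (Fin N) (Fin N) ℝ}

/-! Centred at 1/2, competition becomes a change of sign: the state `x` drifts towards the signed
average `response A x`, perturbed by martingale differences. With a positive stationary vector `v`
of `A`, the squared norm `energy v x` is a Lyapunov function: its drift is minus `dirichlet A v x`,
a nonnegative form, up to an error of order `r n ^ 2` (`energy_succ`). Hence the energy converges
and the sum of `r n * dirichlet` is finite; as the steps are not summable, some subsequence
converges to a zero `y` of the form (`exists_subseq_dirichlet_eq_zero`).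

Such a `y` changes sign along every edge. If the graph is not bipartite, `y = 0`, so the whole
energy tends to 0. If it is bipartite, `y` is a multiple of the sign vector `partSign I`, and the
signed mean `partMean` is a convergent martingale. Energy minus its square is a variance that
vanishes along the subsequence, hence along the whole sequence.

If the limit were constant, the bounded martingale `partMean` would be constant from time 0.
Conditional independence then makes every action deterministic given the past, which forces all
coordinates to be extreme and the first actions to repeat the initial state; that state is then one
of the two frozen ones (`frozen_of_tendsto_const`). -/

lemma eq_of_accessible {α : Type*} {G : Digraph (Fin N)} {f : Fin N → α}
    (hf : ∀ i j, G.Adj i j → f i = f j) {i j : Fin N} (h : Accessible G i j) : f i = f j := by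
  induction h with
  | single h => exact hf _ _ h
  | tail _ h ih => exact ih.trans (hf _ _ h)

lemma IsIrreducible.eq_of_adj {α : Type*} {G : Digraph (Fin N)} (hG : IsIrreducible G)
    {f : Fin N → α} (hf : ∀ i j, G.Adj i j → f i = f j) (i j : Fin N) : f i = f j := by
  by_cases hij : i = j
  · rw [hij]
  · exact eq_of_accessible hf (hG i j hij).1

/-- `v` is a positive stationary probability vector of the weight matrix `A`. -/
structure IsStationary (A : Matrix (Fin N) (Fin N) ℝ) (v : Fin N → ℝ) : Prop where
  pos : ∀ i, 0 < v i
  sum_eq_one : ∑ i, v i = 1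
  sum_mul : ∀ j, ∑ i, v i * A i j = v j

/-- Since `A` fixes the vector of ones, `A - 1` is singular and has a left null vector `w`, possibly
of mixed sign. Entrywise `|w|` is at most its image under `A`, and both have the same total, so
equality holds; irreducibility then spreads positivity from one coordinate to all. -/
lemma exists_isStationary (hN : 1 ≤ N) (hA : A ∈ Matrix.rowStochastic ℝ (Fin N))
    (hG : IsIrreducible (interactionGraph A)) : ∃ v, IsStationary A v := by
  obtain ⟨hA0, hA1⟩ := Matrix.mem_rowStochastic_iff_sum.1 hA
  have hdet : (A - 1).det = 0 := by
    rw [← Matrix.exists_mulVec_eq_zero_iff]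
    refine ⟨1, fun h => ?_, ?_⟩
    · simpa using congrFun h ⟨0, hN⟩
    · rw [Matrix.sub_mulVec, Matrix.one_vecMul_of_mem_rowStochastic hA, Matrix.one_mulVec, sub_self]
  obtain ⟨w, hw0, hw⟩ := Matrix.exists_vecMul_eq_zero_iff.2 hdet
  have hwA : ∀ j, ∑ i, w i * A i j = w j := by
    intro j
    have := congrFun hw j
    rw [Matrix.vecMul_sub, Matrix.vecMul_one] at this
    simpa [Matrix.vecMul, dotProduct, sub_eq_zero] using this
  have hle : ∀ j ∈ Finset.univ, |w j| ≤ ∑ i, |w i| * A i j := by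
    intro j _
    calc |w j| = |∑ i, w i * A i j| := by rw [hwA]
      _ ≤ ∑ i, |w i * A i j| := Finset.abs_sum_le_sum_abs _ _
      _ = ∑ i, |w i| * A i j := by simp_rw [abs_mul, abs_of_nonneg (hA0 _ _)]
  have hsum : ∑ j, |w j| = ∑ j, ∑ i, |w i| * A i j := by
    rw [Finset.sum_comm]
    simp_rw [← Finset.mul_sum, hA1, mul_one]
  have heq := (Finset.sum_eq_sum_iff_of_le hle).1 hsum
  obtain ⟨k, hk⟩ := Function.ne_iff.1 hw0
  have hkpos : 0 < |w k| := abs_pos.2 hk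
  have hadj : ∀ i j, (interactionGraph A).Adj i j → 0 < |w i| → 0 < |w j| := by
    intro i j h hi
    rw [heq j (Finset.mem_univ j)]
    exact Finset.sum_pos' (fun l _ => mul_nonneg (abs_nonneg _) (hA0 _ _))
      ⟨i, Finset.mem_univ i, mul_pos hi (lt_of_le_of_ne (hA0 i j) h.2.symm)⟩
  have hpos : ∀ j, 0 < |w j| := by
    intro j
    by_cases hkj : k = j
    · rwa [← hkj]
    · have hacc : Accessible (interactionGraph A) k j := (hG k j hkj).1
      induction hacc with
      | single h => exact hadj _ _ h hkpos
      | @tail b c hkb h ih =>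
        -- The path may return to `k`, where the induction hypothesis does not apply.
        by_cases hb : k = b
        · exact hadj _ _ h (hb ▸ hkpos)
        · exact hadj _ _ h (ih hb)
  have htot : 0 < ∑ j, |w j| := Finset.sum_pos (fun j _ => hpos j) ⟨k, Finset.mem_univ k⟩
  refine ⟨fun i => |w i| / ∑ j, |w j|, fun i => div_pos (hpos i) htot, ?_, fun j => ?_⟩
  · rw [← Finset.sum_div, div_self htot.ne']
  · rw [heq j (Finset.mem_univ j), Finset.sum_div]
    exact Finset.sum_congr rfl fun i _ => by ring

lemma IsStationary.exists_ne_zero {v : Fin N → ℝ} (hv : IsStationary A v) (j : Fin N) :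
    ∃ i, A i j ≠ 0 := by
  by_contra! h
  have := hv.sum_mul j
  simp only [h, mul_zero, Finset.sum_const_zero] at this
  exact (hv.pos j).ne this

/-- The sign of the influence of `j` on `i`: an agent cooperates with itself and competes with
the others. -/
def influenceSign (i j : Fin N) : ℝ := if i = j then 1 else -1

lemma influenceSign_sq (i j : Fin N) : influenceSign i j ^ 2 = 1 := by
  unfold influenceSign; split_ifs <;> norm_num

/-- The signed averaging operator: the mean action of agent `i`, centred at `1 / 2`, when the
centred state is `x`. -/
def response (A : Matrix (Fin N) (Fin N) ℝ) (x : Fin N → ℝ) (i : Fin N) : ℝ :=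
  ∑ j, A i j * (influenceSign i j * x j)

/-- The energy of a centred state, weighted by `v`. -/
def energy (v x : Fin N → ℝ) : ℝ := ∑ i, v i * x i ^ 2

/-- The Dirichlet form measuring the defect of `x` from being fixed by `response A`. -/
def dirichlet (A : Matrix (Fin N) (Fin N) ℝ) (v x : Fin N → ℝ) : ℝ :=
  ∑ i, ∑ j, v i * A i j * (x i - influenceSign i j * x j) ^ 2

lemma continuous_energy (v : Fin N → ℝ) : Continuous (energy v) := by
  unfold energy; fun_prop

lemma continuous_dirichlet (v : Fin N → ℝ) : Continuous (dirichlet A v) := by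
  unfold dirichlet; fun_prop

lemma continuous_response (i : Fin N) : Continuous fun x => response A x i := by
  unfold response; fun_prop

lemma energy_nonneg {v : Fin N → ℝ} (hv : IsStationary A v) (x : Fin N → ℝ) : 0 ≤ energy v x :=
  Finset.sum_nonneg fun i _ => mul_nonneg (hv.pos i).le (sq_nonneg _)

lemma dirichlet_nonneg (hA : A ∈ Matrix.rowStochastic ℝ (Fin N)) {v : Fin N → ℝ}
    (hv : IsStationary A v) (x : Fin N → ℝ) : 0 ≤ dirichlet A v x :=
  Finset.sum_nonneg fun i _ => Finset.sum_nonneg fun _ _ =>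
    mul_nonneg (mul_nonneg (hv.pos i).le (Matrix.nonneg_of_mem_rowStochastic hA)) (sq_nonneg _)

/-- Expanding the square, the row sums turn the `x i ^ 2` terms into the energy and stationarity
does the same for the `x j ^ 2` terms. No reversibility is needed. -/
lemma dirichlet_eq (hA : A ∈ Matrix.rowStochastic ℝ (Fin N)) {v : Fin N → ℝ}
    (hv : IsStationary A v) (x : Fin N → ℝ) :
    dirichlet A v x = 2 * ∑ i, v i * x i * (x i - response A x i) := by
  have h1 : ∑ i, ∑ j, v i * A i j * x i ^ 2 = energy v x :=
    Finset.sum_congr rfl fun i _ => by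
      rw [← Finset.sum_mul, ← Finset.mul_sum, Matrix.sum_row_of_mem_rowStochastic hA, mul_one]
  have h2 : ∑ i, ∑ j, v i * A i j * x j ^ 2 = energy v x := by
    rw [Finset.sum_comm]
    exact Finset.sum_congr rfl fun j _ => by rw [← Finset.sum_mul, hv.sum_mul]
  have h3 : ∑ i, v i * x i * (x i - response A x i)
      = energy v x - ∑ i, ∑ j, v i * A i j * (x i * (influenceSign i j * x j)) := by
    unfold energy response
    rw [← Finset.sum_sub_distrib]
    refine Finset.sum_congr rfl fun i _ => ?_
    rw [mul_sub, Finset.mul_sum]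
    congr 1
    · ring
    · exact Finset.sum_congr rfl fun j _ => by ring
  rw [h3, mul_sub, two_mul]
  nth_rewrite 1 [← h1]
  rw [← h2, Finset.mul_sum, ← Finset.sum_add_distrib, ← Finset.sum_sub_distrib]
  refine Finset.sum_congr rfl fun i _ => ?_
  rw [Finset.mul_sum, ← Finset.sum_add_distrib, ← Finset.sum_sub_distrib]
  refine Finset.sum_congr rfl fun j _ => ?_
  linear_combination (v i * A i j * x j ^ 2) * influenceSign_sq i j

lemma eq_neg_of_dirichlet_eq_zero (hA : A ∈ Matrix.rowStochastic ℝ (Fin N)) {v : Fin N → ℝ}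
    (hv : IsStationary A v) {x : Fin N → ℝ} (h : dirichlet A v x = 0) {i j : Fin N}
    (hij : (interactionGraph A).Adj i j) : x i = -x j := by
  have hnn : ∀ i j, 0 ≤ v i * A i j * (x i - influenceSign i j * x j) ^ 2 := fun i j =>
    mul_nonneg (mul_nonneg (hv.pos i).le (Matrix.nonneg_of_mem_rowStochastic hA)) (sq_nonneg _)
  have h1 := (Finset.sum_eq_zero_iff_of_nonneg
    fun i _ => Finset.sum_nonneg fun j _ => hnn i j).1 h i (Finset.mem_univ i)
  have h2 := (Finset.sum_eq_zero_iff_of_nonneg fun j _ => hnn i j).1 h1 j (Finset.mem_univ j)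
  have h3 : x i - influenceSign i j * x j = 0 := by
    simpa [(hv.pos i).ne', hij.2] using h2
  rw [influenceSign, if_neg hij.1] at h3
  linarith

/-- A zero of the form flips sign along edges, so its absolute value is constant; were it nonzero,
the signs of its coordinates would give a bipartition. -/
lemma eq_zero_of_dirichlet_eq_zero (hA : A ∈ Matrix.rowStochastic ℝ (Fin N))
    (hG : IsIrreducible (interactionGraph A)) (hb : ¬ IsBipartite (interactionGraph A))
    {v : Fin N → ℝ} (hv : IsStationary A v) {x : Fin N → ℝ} (h : dirichlet A v x = 0) :
    x = 0 := by
  have hadj := fun i j => eq_neg_of_dirichlet_eq_zero hA hv h (i := i) (j := j)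
  have habs : ∀ i j, |x i| = |x j| :=
    hG.eq_of_adj (f := fun i => |x i|) fun i j hij => by simp [hadj i j hij]
  by_contra hx
  obtain ⟨k, hk⟩ := Function.ne_iff.1 hx
  have hne : ∀ i, x i ≠ 0 := fun i => by
    rw [← abs_pos, habs i k]; exact abs_pos.2 hk
  refine hb ⟨{i | 0 < x i}, {i | 0 < x i}ᶜ, isCompl_compl, fun i j hij => ?_⟩
  have := hadj i j hij
  simp only [Set.mem_compl_iff, Set.mem_ofPred_eq, not_lt]
  rcases lt_or_gt_of_ne (hne i) with hi | hi
  · exact Or.inr ⟨hi.le, by linarith⟩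
  · exact Or.inl ⟨hi, by linarith⟩

open Classical in
/-- The sign vector `1` on `I` and `-1` off `I`. -/
noncomputable def partSign (I : Set (Fin N)) (i : Fin N) : ℝ := if i ∈ I then 1 else -1

lemma partSign_mul_self (I : Set (Fin N)) (i : Fin N) : partSign I i * partSign I i = 1 := by
  unfold partSign; split_ifs <;> norm_num

lemma partSign_ne_zero (I : Set (Fin N)) (i : Fin N) : partSign I i ≠ 0 := by
  unfold partSign; split_ifs <;> norm_num

lemma partSign_of_mem {I : Set (Fin N)} {i : Fin N} (hi : i ∈ I) : partSign I i = 1 := if_pos hi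

lemma IsBipartition.partSign_right {G : Digraph (Fin N)} {I J : Set (Fin N)}
    (hIJ : IsBipartition G I J) {i : Fin N} (hi : i ∈ J) : partSign I i = -1 :=
  if_neg fun h => Set.disjoint_left.1 hIJ.1.disjoint h hi

lemma IsBipartition.partSign_eq_neg {G : Digraph (Fin N)} {I J : Set (Fin N)}
    (hIJ : IsBipartition G I J) {i j : Fin N} (hij : G.Adj i j) :
    partSign I i = -partSign I j := by
  rcases hIJ.2 i j hij with ⟨hi, hj⟩ | ⟨hi, hj⟩
  · rw [partSign, if_pos hi, hIJ.partSign_right hj, neg_neg]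
  · rw [hIJ.partSign_right hi, partSign, if_pos hj]

/-- Multiplication by `partSign` conjugates the signed response into plain averaging by `A`: the
sign change along an edge cancels the competition. -/
lemma IsBipartition.weight_mul_partSign {I J : Set (Fin N)}
    (hIJ : IsBipartition (interactionGraph A) I J) (i j : Fin N) :
    A i j * (partSign I i * influenceSign i j) = A i j * partSign I j := by
  by_cases hij : i = j
  · simp [hij, influenceSign]
  · by_cases h : A i j = 0
    · simp [h]
    · rw [influenceSign, if_neg hij, hIJ.partSign_eq_neg (i := i) (j := j) ⟨hij, h⟩]
      ring

/-- The `v`-average of the coordinates of `x`, with those off `I` reversed. -/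
noncomputable def partMean (v : Fin N → ℝ) (I : Set (Fin N)) (x : Fin N → ℝ) : ℝ :=
  ∑ j, v j * (partSign I j * x j)

lemma IsBipartition.eq_mul_partSign_of_dirichlet_eq_zero
    (hA : A ∈ Matrix.rowStochastic ℝ (Fin N)) (hG : IsIrreducible (interactionGraph A))
    {I J : Set (Fin N)} (hIJ : IsBipartition (interactionGraph A) I J)
    {v : Fin N → ℝ} (hv : IsStationary A v) {x : Fin N → ℝ} (h : dirichlet A v x = 0)
    (i : Fin N) : x i = partMean v I x * partSign I i := by
  have hconst : ∀ j, partSign I j * x j = partSign I i * x i := fun j =>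
    hG.eq_of_adj (f := fun j => partSign I j * x j) (fun k l hkl => by
      rw [eq_neg_of_dirichlet_eq_zero hA hv h hkl, hIJ.partSign_eq_neg hkl, neg_mul_neg]) j i
  simp_rw [partMean, hconst, ← Finset.sum_mul, hv.sum_eq_one]
  linear_combination (-x i) * partSign_mul_self I i

/-- After that conjugation this is stationarity of `v`. The drift thus conserves the signed mean,
which makes it a martingale. -/
lemma IsBipartition.partMean_response {I J : Set (Fin N)}
    (hIJ : IsBipartition (interactionGraph A) I J) {v : Fin N → ℝ} (hv : IsStationary A v)
    (x : Fin N → ℝ) :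
    partMean v I (response A x) = partMean v I x := by
  calc partMean v I (response A x)
      = ∑ i, ∑ j, v i * A i j * (partSign I j * x j) := by
        refine Finset.sum_congr rfl fun i _ => ?_
        rw [response, Finset.mul_sum, Finset.mul_sum]
        refine Finset.sum_congr rfl fun j _ => ?_
        linear_combination (v i * x j) * hIJ.weight_mul_partSign i j
    _ = _ := by
        rw [Finset.sum_comm]
        exact Finset.sum_congr rfl fun j _ => by rw [← Finset.sum_mul, hv.sum_mul]

/-- This is the variance identity for `partSign I i * x i` under the probability vector `v`. -/
lemma energy_sub_mul_partSign (I : Set (Fin N)) {v : Fin N → ℝ} (hv : IsStationary A v)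
    (x : Fin N → ℝ) :
    energy v (fun i => x i - partMean v I x * partSign I i)
      = energy v x - partMean v I x ^ 2 := by
  set m := partMean v I x with hm
  rw [partMean] at hm
  have h1 : ∀ i, v i * (x i - m * partSign I i) ^ 2
      = v i * x i ^ 2 - 2 * m * (v i * (partSign I i * x i)) + m ^ 2 * v i := fun i => by
    linear_combination (v i * m ^ 2) * partSign_mul_self I i
  simp_rw [energy, h1, Finset.sum_add_distrib, Finset.sum_sub_distrib, ← Finset.mul_sum,
    hv.sum_eq_one, ← hm]
  ring

lemma continuous_partMean (v : Fin N → ℝ) (I : Set (Fin N)) : Continuous (partMean v I) := by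
  unfold partMean; fun_prop

lemma abs_response_le (hA : A ∈ Matrix.rowStochastic ℝ (Fin N)) {x : Fin N → ℝ} {c : ℝ}
    (hx : ∀ i, |x i| ≤ c) (i : Fin N) : |response A x i| ≤ c := by
  calc |response A x i| ≤ ∑ j, |A i j * (influenceSign i j * x j)| :=
        Finset.abs_sum_le_sum_abs _ _
    _ ≤ ∑ j, A i j * c := by
        refine Finset.sum_le_sum fun j _ => ?_
        have hs : |influenceSign i j| = 1 := by
          rw [← sq_eq_sq₀ (abs_nonneg _) zero_le_one, sq_abs, influenceSign_sq, one_pow]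
        rw [abs_mul, abs_mul, hs, one_mul, abs_of_nonneg (Matrix.nonneg_of_mem_rowStochastic hA)]
        exact mul_le_mul_of_nonneg_left (hx j) (Matrix.nonneg_of_mem_rowStochastic hA)
    _ = c := by rw [← Finset.sum_mul, Matrix.sum_row_of_mem_rowStochastic hA, one_mul]

lemma response_neg (x : Fin N → ℝ) (i : Fin N) : response A (-x) i = -response A x i := by
  simp only [response, Pi.neg_apply, mul_neg, Finset.sum_neg_distrib]

/-- Equality case of an average: terms at most `c` average to `c` only if each term of nonzero
weight equals `c`. -/
lemma influenceSign_mul_eq_of_response_eq (hA : A ∈ Matrix.rowStochastic ℝ (Fin N))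
    {x : Fin N → ℝ} {c : ℝ} (hx : ∀ i, |x i| ≤ c) {i j : Fin N} (h : response A x i = c)
    (hij : A i j ≠ 0) : influenceSign i j * x j = c := by
  have hle : ∀ k, influenceSign i k * x k ≤ c := fun k => by
    obtain ⟨h1, h2⟩ := abs_le.1 (hx k)
    unfold influenceSign
    split_ifs <;> linarith
  have hsum : ∑ k, A i k * (c - influenceSign i k * x k) = 0 := by
    simp_rw [mul_sub, Finset.sum_sub_distrib, ← Finset.sum_mul,
      Matrix.sum_row_of_mem_rowStochastic hA]
    rw [response] at h
    rw [h, one_mul, sub_self]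
  have h0 := (Finset.sum_eq_zero_iff_of_nonneg fun k _ =>
    mul_nonneg (Matrix.nonneg_of_mem_rowStochastic hA) (sub_nonneg.2 (hle k))).1 hsum j
    (Finset.mem_univ j)
  exact (sub_eq_zero.1 ((mul_eq_zero.1 h0).resolve_left hij)).symm

lemma abs_eq_of_abs_response_eq (hA : A ∈ Matrix.rowStochastic ℝ (Fin N))
    {x : Fin N → ℝ} {c : ℝ} (hx : ∀ i, |x i| ≤ c) {i j : Fin N} (h : |response A x i| = c)
    (hij : A i j ≠ 0) : |x j| = c := by
  have key : |influenceSign i j * x j| = c := by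
    rcases abs_choice (response A x i) with h1 | h1 <;> rw [h1] at h
    · rw [influenceSign_mul_eq_of_response_eq hA hx h hij, abs_of_nonneg]
      exact (abs_nonneg _).trans (hx j)
    · have h2 := influenceSign_mul_eq_of_response_eq hA (x := -x) (c := c)
        (fun k => by simpa using hx k) (by rw [response_neg, h]) hij
      rw [← abs_neg, ← mul_neg]
      rw [Pi.neg_apply] at h2
      rw [h2, abs_of_nonneg]
      exact (abs_nonneg _).trans (hx j)
  unfold influenceSign at key
  split_ifs at key <;> simpa using key

end WeightMatrix

/-! ### Bounded martingales and martingale series -/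

section MartingaleSeries

variable {Ω : Type*} {mΩ : MeasurableSpace Ω} {μ : Measure Ω} [IsProbabilityMeasure μ]
  {ℱ : Filtration ℕ mΩ}

/-- The sum of martingale differences bounded by a square summable sequence converges almost
surely. -/
theorem ae_exists_tendsto_sum_of_condExp_eq_zero {d : ℕ → Ω → ℝ} {c : ℕ → ℝ}
    (hd : ∀ n, Measurable[ℱ (n + 1)] (d n)) (hbound : ∀ n ω, |d n ω| ≤ c n)
    (hc : Summable fun n => c n ^ 2) (hcond : ∀ n, μ[d n | ℱ n] =ᵐ[μ] 0) :
    ∀ᵐ ω ∂μ, ∃ l, Tendsto (fun n => ∑ k ∈ Finset.range n, d k ω) atTop (𝓝 l) := by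
  set K : ℕ → Ω → ℝ := fun n ω => ∑ k ∈ Finset.range n, d k ω with hK
  have hKsucc : ∀ n ω, K (n + 1) ω = K n ω + d n ω := fun n ω => Finset.sum_range_succ _ _
  have hKmeas : ∀ n, Measurable[ℱ n] (K n) := fun n =>
    Finset.measurable_sum _ fun k hk =>
      (hd k).mono (ℱ.mono (Nat.succ_le_of_lt (Finset.mem_range.1 hk))) le_rfl
  have hKbound : ∀ n ω, |K n ω| ≤ ∑ k ∈ Finset.range n, c k := fun n ω =>
    (Finset.abs_sum_le_sum_abs _ _).trans (Finset.sum_le_sum fun k _ => hbound k ω)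
  have hdint : ∀ n, Integrable (d n) μ := fun n =>
    Integrable.of_bound ((hd n).mono (ℱ.le _) le_rfl).aestronglyMeasurable (c n)
      (ae_of_all _ (hbound n))
  have hKm : ∀ n, AEStronglyMeasurable (K n) μ := fun n =>
    ((hKmeas n).mono (ℱ.le _) le_rfl).aestronglyMeasurable
  have hKint : ∀ n, Integrable (K n) μ := fun n =>
    Integrable.of_bound (hKm n) _ (ae_of_all _ (hKbound n))
  have hKsq : ∀ n, Integrable (fun ω => K n ω ^ 2) μ := fun n =>
    Integrable.of_bound ((hKm n).pow 2) ((∑ k ∈ Finset.range n, c k) ^ 2) (ae_of_all _ fun ω => by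
      rw [Real.norm_eq_abs, abs_pow]
      exact pow_le_pow_left₀ (abs_nonneg _) (hKbound n ω) 2)
  have hKd : ∀ n, Integrable (fun ω => K n ω * d n ω) μ := fun n =>
    (hdint n).bdd_mul (hKm n) (ae_of_all _ (hKbound n))
  -- Orthogonality of each increment to the past removes the cross term, so the second moment of `K
  -- n` is at most the sum of the `c k ^ 2`.
  have horth : ∀ n, ∫ ω, K n ω * d n ω ∂μ = 0 := by
    intro n
    have h1 : μ[K n * d n | ℱ n] =ᵐ[μ] 0 := by
      filter_upwards [condExp_mul_of_stronglyMeasurable_left (hKmeas n).stronglyMeasurable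
        (hKd n) (hdint n), hcond n] with ω h h0
      rw [h, Pi.mul_apply, h0, Pi.zero_apply, mul_zero]
    calc ∫ ω, K n ω * d n ω ∂μ = ∫ ω, (μ[K n * d n | ℱ n]) ω ∂μ := (integral_condExp (ℱ.le n)).symm
      _ = 0 := by rw [integral_congr_ae h1]; simp
  have hsq : ∀ n, ∫ ω, K n ω ^ 2 ∂μ ≤ ∑ k ∈ Finset.range n, c k ^ 2 := by
    intro n
    induction n with
    | zero => simp [hK]
    | succ n ih =>
      have hle : ∀ ω, K (n + 1) ω ^ 2 ≤ K n ω ^ 2 + 2 * (K n ω * d n ω) + c n ^ 2 := fun ω => by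
        rw [hKsucc]
        have : d n ω ^ 2 ≤ c n ^ 2 := sq_le_sq' (abs_le.1 (hbound n ω)).1 (abs_le.1 (hbound n ω)).2
        linarith
      have hint : Integrable (fun ω => K n ω ^ 2 + 2 * (K n ω * d n ω)) μ :=
        (hKsq n).add ((hKd n).const_mul 2)
      calc ∫ ω, K (n + 1) ω ^ 2 ∂μ
          ≤ ∫ ω, (K n ω ^ 2 + 2 * (K n ω * d n ω) + c n ^ 2) ∂μ :=
            integral_mono (hKsq _) (hint.add (integrable_const _)) hle
        _ = ∫ ω, K n ω ^ 2 ∂μ + c n ^ 2 := by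
            rw [integral_add hint (integrable_const _),
              integral_add (hKsq n) ((hKd n).const_mul 2), integral_const_mul, horth]
            simp
        _ ≤ _ := by rw [Finset.sum_range_succ]; linarith
  have hmart : Martingale K ℱ μ := by
    refine martingale_of_condExp_sub_eq_zero_nat (fun n => (hKmeas n).stronglyMeasurable) hKint
      fun n => ?_
    have : K (n + 1) - K n = d n := by funext ω; simp [hKsucc]
    rw [this]
    exact hcond n
  -- The inequality `|K| ≤ 1 + K ^ 2` converts the second-moment bound into the first-moment bound
  -- of Doob's convergence theorem.
  have hL1 : ∀ n, eLpNorm (K n) 1 μ ≤ (((1 + ∑' k, c k ^ 2).toNNReal : NNReal) : ENNReal) := by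
    intro n
    have h1 : ∫ ω, ‖K n ω‖ ∂μ ≤ 1 + ∑' k, c k ^ 2 := by
      calc ∫ ω, ‖K n ω‖ ∂μ ≤ ∫ ω, (1 + K n ω ^ 2) ∂μ := by
            refine integral_mono (hKint n).norm ((integrable_const 1).add (hKsq n)) fun ω => ?_
            rw [Real.norm_eq_abs, ← sq_abs]
            nlinarith [sq_nonneg (|K n ω| - 1), abs_nonneg (K n ω)]
        _ = 1 + ∫ ω, K n ω ^ 2 ∂μ := by
            rw [integral_add (integrable_const 1) (hKsq n)]; simp
        _ ≤ _ := by
            gcongr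
            exact (hsq n).trans (hc.sum_le_tsum _ fun k _ => sq_nonneg _)
    rw [eLpNorm_one_eq_lintegral_enorm, ← ofReal_integral_norm_eq_lintegral_enorm (hKint n)]
    exact ENNReal.ofReal_le_ofReal h1
  exact hmart.submartingale.exists_ae_tendsto_of_bdd hL1

/-- A uniformly bounded martingale which converges almost surely to a constant is constant. -/
theorem ae_eq_const_of_tendsto {M : ℕ → Ω → ℝ} (hM : Martingale M ℱ μ) {C x : ℝ}
    (hbound : ∀ n ω, |M n ω| ≤ C) (hlim : ∀ᵐ ω ∂μ, Tendsto (fun n => M n ω) atTop (𝓝 x))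
    (n : ℕ) : M n =ᵐ[μ] fun _ => x := by
  have hint := hM.integrable
  -- The integral over `s` is the same for all later times, and dominated convergence identifies it.
  have hset : ∀ s, MeasurableSet[ℱ n] s → ∫ ω in s, M n ω ∂μ = ∫ ω in s, x ∂μ := by
    intro s hs
    have hconv : Tendsto (fun m => ∫ ω in s, M m ω ∂μ) atTop (𝓝 (∫ ω in s, x ∂μ)) :=
      tendsto_integral_of_dominated_convergence (fun _ => C)
        (fun m => (hint m).aestronglyMeasurable.restrict) (integrable_const _)
        (fun m => ae_of_all _ (hbound m)) (ae_restrict_of_ae hlim)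
    refine tendsto_nhds_unique (tendsto_const_nhds.congr' ?_) hconv
    filter_upwards [eventually_ge_atTop n] with m hm
    exact hM.setIntegral_eq hm hs
  have h1 : (fun _ => x) =ᵐ[μ] μ[M n | ℱ n] :=
    ae_eq_condExp_of_forall_setIntegral_eq (ℱ.le n) (hint n)
      (fun s _ _ => (integrable_const x).integrableOn) (fun s hs _ => (hset s hs).symm)
      stronglyMeasurable_const.aestronglyMeasurable
  rw [condExp_of_stronglyMeasurable (ℱ.le n) (hM.stronglyMeasurable n) (hint n)] at h1
  exact h1.symm

end MartingaleSeries

/-! ### Pathwise Lyapunov argument -/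

section Deterministic

/-- Telescoping expresses the partial sums of `r n * D n` through `V`, `a` and `e`; nonnegativity of
`V` bounds them, and then every other term of the telescoped identity converges. -/
lemma tendsto_and_summable_of_recursion {V D a e r : ℕ → ℝ} (hV : ∀ n, 0 ≤ V n)
    (hD : ∀ n, 0 ≤ r n * D n) (hr : Summable fun n => r n ^ 2) (he0 : ∀ n, 0 ≤ e n)
    (he : ∀ n, e n ≤ r n ^ 2)
    (ha : ∃ l, Tendsto (fun n => ∑ k ∈ Finset.range n, a k) atTop (𝓝 l))
    (hrec : ∀ n, V (n + 1) = V n - r n * D n + a n + e n) :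
    (∃ L, Tendsto V atTop (𝓝 L)) ∧ Summable fun n => r n * D n := by
  have heS : Summable e := Summable.of_nonneg_of_le he0 he hr
  obtain ⟨l, hl⟩ := ha
  have hsum : ∀ n, V n = V 0 - ∑ k ∈ Finset.range n, r k * D k + ∑ k ∈ Finset.range n, a k
      + ∑ k ∈ Finset.range n, e k := by
    intro n
    induction n with
    | zero => simp
    | succ n ih => rw [hrec, ih]; simp only [Finset.sum_range_succ]; ring
  obtain ⟨B, hB⟩ := hl.bddAbove_range
  have hDS : Summable fun n => r n * D n := by
    refine summable_of_sum_range_le (c := V 0 + B + ∑' k, e k) hD fun n => ?_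
    have h1 : ∑ k ∈ Finset.range n, a k ≤ B := hB ⟨n, rfl⟩
    have h2 : ∑ k ∈ Finset.range n, e k ≤ ∑' k, e k := heS.sum_le_tsum _ fun k _ => he0 k
    linarith [hsum n, hV n]
  have hlim := ((tendsto_const_nhds (x := V 0)).sub hDS.hasSum.tendsto_sum_nat).add hl |>.add
    heS.hasSum.tendsto_sum_nat
  exact ⟨⟨_, hlim.congr fun n => (hsum n).symm⟩, hDS⟩

/-- Otherwise `r n` would eventually be dominated by a multiple of the summable `r n * D n`. -/
lemma IsStepSequence.frequently_lt {r D : ℕ → ℝ} (hr : IsStepSequence r)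
    (hrD : Summable fun n => r n * D n) {ε : ℝ} (hε : 0 < ε) : ∃ᶠ n in atTop, D n < ε := by
  intro h
  have hev : ∀ᶠ n in atTop, ‖r n‖ ≤ ε⁻¹ * (r n * D n) := by
    filter_upwards [h] with n hn
    have h0 := (hr.mem_Ioo n).1
    rw [Real.norm_eq_abs, abs_of_pos h0, inv_mul_eq_div, le_div_iff₀ hε]
    exact mul_le_mul_of_nonneg_left (not_lt.1 hn) h0.le
  have hS : Summable r := (hrD.mul_left ε⁻¹).of_norm_bounded_eventually_nat hev
  exact not_tendsto_nhds_of_tendsto_atTop hr.sum_eq_top _ hS.hasSum.tendsto_sum_nat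

lemma exists_subseq_dirichlet_eq_zero {N : ℕ} {A : Matrix (Fin N) (Fin N) ℝ}
    (hA : A ∈ Matrix.rowStochastic ℝ (Fin N)) {v : Fin N → ℝ} (hv : IsStationary A v)
    {r : ℕ → ℝ} (hr : IsStepSequence r) {x : ℕ → Fin N → ℝ} {c : ℝ} (hc : 0 ≤ c)
    (hx : ∀ n i, |x n i| ≤ c) (hsum : Summable fun n => r n * dirichlet A v (x n)) :
    ∃ y, dirichlet A v y = 0 ∧ ∃ φ : ℕ → ℕ, StrictMono φ ∧ Tendsto (x ∘ φ) atTop (𝓝 y) := by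
  obtain ⟨φ, hφ, hlt⟩ := extraction_forall_of_frequently
    (P := fun n k => dirichlet A v (x k) < 1 / ((n : ℝ) + 1))
    fun n => hr.frequently_lt hsum Nat.one_div_pos_of_nat
  obtain ⟨y, -, ψ, hψ, hy⟩ := (isCompact_closedBall (0 : Fin N → ℝ) c).tendsto_subseq
    (x := x ∘ φ) fun n => by
      rw [mem_closedBall_zero_iff]
      exact (pi_norm_le_iff_of_nonneg hc).2 fun i => hx _ i
  have h0 : Tendsto (fun n => dirichlet A v (x (φ n))) atTop (𝓝 0) :=
    squeeze_zero (fun n => dirichlet_nonneg hA hv _) (fun n => (hlt n).le)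
      tendsto_one_div_add_atTop_nhds_zero_nat
  refine ⟨y, ?_, φ ∘ ψ, hφ.comp hψ, hy⟩
  exact tendsto_nhds_unique (((continuous_dirichlet v).tendsto y).comp hy)
    (h0.comp hψ.tendsto_atTop)

lemma tendsto_zero_of_energy {N : ℕ} {A : Matrix (Fin N) (Fin N) ℝ} {v : Fin N → ℝ}
    (hv : IsStationary A v) {x : ℕ → Fin N → ℝ}
    (h : Tendsto (fun n => energy v (x n)) atTop (𝓝 0)) (i : Fin N) :
    Tendsto (fun n => x n i) atTop (𝓝 0) := by
  have h1 : Tendsto (fun n => x n i ^ 2) atTop (𝓝 0) := by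
    have h2 : Tendsto (fun n => (v i)⁻¹ * energy v (x n)) atTop (𝓝 0) := by
      simpa using h.const_mul (v i)⁻¹
    refine squeeze_zero (fun n => sq_nonneg _) (fun n => ?_) h2
    rw [inv_mul_eq_div, le_div_iff₀ (hv.pos i), mul_comm]
    exact Finset.single_le_sum (f := fun i => v i * x n i ^ 2)
      (fun j _ => mul_nonneg (hv.pos j).le (sq_nonneg _)) (Finset.mem_univ i)
  have h3 := h1.sqrt
  simp_rw [Real.sqrt_sq_eq_abs, Real.sqrt_zero] at h3
  exact (tendsto_zero_iff_abs_tendsto_zero _).2 h3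

end Deterministic

/-- The state centred at `1 / 2`. -/
noncomputable def centred {Ω : Type*} {N : ℕ} (Z : ℕ → Ω → Fin N → ℝ) (n : ℕ) (ω : Ω)
    (i : Fin N) : ℝ := Z n ω i - 1 / 2

/-- The martingale difference driving the dynamics. -/
noncomputable def innovation {Ω : Type*} {N : ℕ} (A : Matrix (Fin N) (Fin N) ℝ)
    (Z Y : ℕ → Ω → Fin N → ℝ) (n : ℕ) (ω : Ω) (i : Fin N) : ℝ :=
  Y (n + 1) ω i - 1 / 2 - response A (centred Z n ω) i

/-- About 1/2, the map `z ↦ 1 - z` is a change of sign; the constants add up to 1/2 because the row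
sums to 1. -/
lemma mean_action_eq {N : ℕ} {A : Matrix (Fin N) (Fin N) ℝ}
    (hA : A ∈ Matrix.rowStochastic ℝ (Fin N)) (z : Fin N → ℝ) (i : Fin N) :
    A i i * z i + ∑ j ∈ Finset.univ.erase i, A i j * (1 - z j)
      = 1 / 2 + response A (fun j => z j - 1 / 2) i := by
  have h1 := Matrix.sum_row_of_mem_rowStochastic hA i
  rw [← Finset.add_sum_erase _ _ (Finset.mem_univ i)] at h1
  rw [response, ← Finset.add_sum_erase _ _ (Finset.mem_univ i)]
  have h2 : ∑ j ∈ Finset.univ.erase i, A i j * (influenceSign i j * (z j - 1 / 2))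
      = ∑ j ∈ Finset.univ.erase i, A i j * (1 - z j)
        - 1 / 2 * ∑ j ∈ Finset.univ.erase i, A i j := by
    rw [Finset.mul_sum, ← Finset.sum_sub_distrib]
    refine Finset.sum_congr rfl fun j hj => ?_
    rw [influenceSign, if_neg (Finset.ne_of_mem_erase hj).symm]
    ring
  rw [h2, influenceSign, if_pos rfl]
  linear_combination (1 / 2) * h1

/-! ### Recursion, innovations and energy of the dynamics -/

namespace IsCompetitiveSystem

variable {Ω : Type*} {mΩ : MeasurableSpace Ω} {μ : Measure Ω}
  {ℱ : Filtration ℕ mΩ} {N : ℕ} {A : Matrix (Fin N) (Fin N) ℝ} {r : ℕ → ℝ}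
  {Z Y : ℕ → Ω → Fin N → ℝ}

lemma state_mem (hZ : IsCompetitiveSystem μ ℱ A r Z Y) (hr : IsStepSequence r) (n : ℕ) (ω : Ω)
    (i : Fin N) : Z n ω i ∈ Set.Icc (0 : ℝ) 1 := by
  induction n with
  | zero => exact hZ.init_mem ω i
  | succ n ih =>
    obtain ⟨h0, h1⟩ := hr.mem_Ioo n
    rw [hZ.step]
    rcases hZ.noise_mem n ω i with h | h <;> rw [h] <;> constructor <;> nlinarith [ih.1, ih.2]

lemma measurable_state (hZ : IsCompetitiveSystem μ ℱ A r Z Y) (n : ℕ) : Measurable[ℱ n] (Z n) := by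
  induction n with
  | zero => exact hZ.measurable_init
  | succ n ih =>
    have h1 : Measurable[ℱ (n + 1)] (Z n) := ih.mono (ℱ.mono n.le_succ) le_rfl
    refine (@measurable_pi_iff _ _ _ (ℱ (n + 1)) _ _).2 fun i => ?_
    simp_rw [hZ.step]
    exact (((measurable_pi_apply i).comp h1).const_mul _).add
      (((measurable_pi_apply i).comp (hZ.measurable_noise n)).const_mul _)

lemma measurable_centred (hZ : IsCompetitiveSystem μ ℱ A r Z Y) (n : ℕ) :
    Measurable[ℱ n] (centred Z n) :=
  (@measurable_pi_iff _ _ _ (ℱ n) _ _).2 fun i =>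
    ((measurable_pi_apply i).comp (hZ.measurable_state n)).sub_const _

lemma abs_centred_le (hZ : IsCompetitiveSystem μ ℱ A r Z Y) (hr : IsStepSequence r) (n : ℕ)
    (ω : Ω) (i : Fin N) : |centred Z n ω i| ≤ 1 / 2 := by
  obtain ⟨h0, h1⟩ := hZ.state_mem hr n ω i
  rw [centred, abs_le]
  constructor <;> linarith

lemma measurable_innovation (hZ : IsCompetitiveSystem μ ℱ A r Z Y) (n : ℕ) (i : Fin N) :
    Measurable[ℱ (n + 1)] fun ω => innovation A Z Y n ω i :=
  (((measurable_pi_apply i).comp (hZ.measurable_noise n)).sub_const _).sub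
    ((continuous_response i).measurable.comp
      ((hZ.measurable_centred n).mono (ℱ.mono n.le_succ) le_rfl))

lemma abs_innovation_le (hZ : IsCompetitiveSystem μ ℱ A r Z Y) (hr : IsStepSequence r)
    (hA : A ∈ Matrix.rowStochastic ℝ (Fin N)) (n : ℕ) (ω : Ω) (i : Fin N) :
    |innovation A Z Y n ω i| ≤ 1 := by
  obtain ⟨h1, h2⟩ := abs_le.1 (abs_response_le hA (hZ.abs_centred_le hr n ω) i)
  rw [innovation, abs_le]
  rcases hZ.noise_mem n ω i with h | h <;> rw [h] <;> constructor <;> linarith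

lemma centred_succ (hZ : IsCompetitiveSystem μ ℱ A r Z Y) (n : ℕ) (ω : Ω) (i : Fin N) :
    centred Z (n + 1) ω i = centred Z n ω i - r n * (centred Z n ω i
      - response A (centred Z n ω) i) + r n * innovation A Z Y n ω i := by
  simp only [innovation, centred, hZ.step]
  ring

lemma condProb_eq (hZ : IsCompetitiveSystem μ ℱ A r Z Y)
    (hA : A ∈ Matrix.rowStochastic ℝ (Fin N)) (n : ℕ) (i : Fin N) :
    μ⟦{ω | Y (n + 1) ω i = 1} | ℱ n⟧ =ᵐ[μ] fun ω => 1 / 2 + response A (centred Z n ω) i := by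
  filter_upwards [hZ.condProb n i] with ω h
  rw [h, mean_action_eq hA]
  rfl

lemma integrable_innovation [IsFiniteMeasure μ] (hZ : IsCompetitiveSystem μ ℱ A r Z Y)
    (hr : IsStepSequence r) (hA : A ∈ Matrix.rowStochastic ℝ (Fin N)) (n : ℕ) (i : Fin N) :
    Integrable (fun ω => innovation A Z Y n ω i) μ :=
  Integrable.of_bound ((hZ.measurable_innovation n i).mono (ℱ.le _) le_rfl).aestronglyMeasurable 1
    (ae_of_all _ fun ω => hZ.abs_innovation_le hr hA n ω i)

lemma indicator_noise (hZ : IsCompetitiveSystem μ ℱ A r Z Y) (n : ℕ) (i : Fin N) :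
    ({ω | Y (n + 1) ω i = 1}.indicator fun _ => (1 : ℝ)) = fun ω => Y (n + 1) ω i := by
  funext ω
  rcases hZ.noise_mem n ω i with h | h <;> simp [Set.indicator, h]

lemma integrable_noise [IsFiniteMeasure μ] (hZ : IsCompetitiveSystem μ ℱ A r Z Y) (n : ℕ)
    (i : Fin N) : Integrable (fun ω => Y (n + 1) ω i) μ := by
  refine Integrable.of_bound (((measurable_pi_apply i).comp (hZ.measurable_noise n)).mono
    (ℱ.le _) le_rfl).aestronglyMeasurable 1 (ae_of_all _ fun ω => ?_)
  rcases hZ.noise_mem n ω i with h | h <;> simp [h]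

lemma condExp_innovation [IsProbabilityMeasure μ] (hZ : IsCompetitiveSystem μ ℱ A r Z Y)
    (hr : IsStepSequence r) (hA : A ∈ Matrix.rowStochastic ℝ (Fin N)) (n : ℕ) (i : Fin N) :
    μ[fun ω => innovation A Z Y n ω i | ℱ n] =ᵐ[μ] 0 := by
  set q : Ω → ℝ := fun ω => 1 / 2 + response A (centred Z n ω) i with hq
  have hqm : Measurable[ℱ n] q :=
    ((continuous_response i).measurable.comp (hZ.measurable_centred n)).const_add _
  have heq : (fun ω => innovation A Z Y n ω i) = (fun ω => Y (n + 1) ω i) - q := by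
    funext ω
    simp only [innovation, hq, Pi.sub_apply]
    ring
  have hqi : Integrable q μ := by
    have := (hZ.integrable_noise n i).sub (hZ.integrable_innovation hr hA n i)
    rw [heq] at this
    simpa using this
  rw [heq]
  refine (condExp_sub (hZ.integrable_noise n i) hqi _).trans ?_
  rw [condExp_of_stronglyMeasurable (ℱ.le n) hqm.stronglyMeasurable hqi, ← hZ.indicator_noise]
  filter_upwards [hZ.condProb_eq hA n i] with ω h
  rw [Pi.sub_apply, h, hq, sub_self, Pi.zero_apply]

lemma condExp_sum_mul_innovation [IsProbabilityMeasure μ] (hZ : IsCompetitiveSystem μ ℱ A r Z Y)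
    (hr : IsStepSequence r) (hA : A ∈ Matrix.rowStochastic ℝ (Fin N)) (n : ℕ)
    {g : Ω → Fin N → ℝ} {C : ℝ} (hg : Measurable[ℱ n] g) (hC : ∀ ω i, |g ω i| ≤ C) :
    μ[fun ω => ∑ i, g ω i * innovation A Z Y n ω i | ℱ n] =ᵐ[μ] 0 := by
  have hgi : ∀ i, Measurable[ℱ n] fun ω => g ω i := fun i => (measurable_pi_apply i).comp hg
  have hint : ∀ i, Integrable (fun ω => g ω i * innovation A Z Y n ω i) μ := fun i =>
    (hZ.integrable_innovation hr hA n i).bdd_mul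
      ((hgi i).mono (ℱ.le n) le_rfl).aestronglyMeasurable (ae_of_all _ fun ω => hC ω i)
  have hsum : (fun ω => ∑ i, g ω i * innovation A Z Y n ω i)
      = ∑ i, fun ω => g ω i * innovation A Z Y n ω i := by
    funext ω
    rw [Finset.sum_apply]
  rw [hsum]
  refine (condExp_finsetSum (fun i _ => hint i) _).trans ?_
  have hzero : ∀ᵐ ω ∂μ, ∀ i, (μ[fun ω => g ω i * innovation A Z Y n ω i | ℱ n]) ω = 0 := by
    refine ae_all_iff.2 fun i => ?_
    filter_upwards [condExp_mul_of_stronglyMeasurable_left (hgi i).stronglyMeasurable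
      (hint i) (hZ.integrable_innovation hr hA n i), hZ.condExp_innovation hr hA n i] with ω h h0
    refine h.trans ?_
    rw [Pi.mul_apply, h0, Pi.zero_apply, mul_zero]
  filter_upwards [hzero] with ω h
  rw [Finset.sum_apply]
  simp [h]

/-- Weighted by a bounded predictable process, the innovations have an almost surely convergent
series. -/
lemma ae_exists_tendsto_sum_innovation [IsProbabilityMeasure μ]
    (hZ : IsCompetitiveSystem μ ℱ A r Z Y) (hr : IsStepSequence r)
    (hA : A ∈ Matrix.rowStochastic ℝ (Fin N)) {g : ℕ → Ω → Fin N → ℝ} {C : ℝ}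
    (hg : ∀ n, Measurable[ℱ n] (g n)) (hC : ∀ n ω i, |g n ω i| ≤ C) :
    ∀ᵐ ω ∂μ, ∃ l, Tendsto (fun n => ∑ k ∈ Finset.range n,
      r k * ∑ i, g k ω i * innovation A Z Y k ω i) atTop (𝓝 l) := by
  -- The bound counts `N` terms, each at most `C` since innovations are at most 1 in absolute value.
  refine ae_exists_tendsto_sum_of_condExp_eq_zero (ℱ := ℱ)
    (d := fun n ω => r n * ∑ i, g n ω i * innovation A Z Y n ω i)
    (c := fun n => r n * (N * C)) (fun n => ?_) (fun n ω => ?_) ?_ fun n => ?_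
  · refine Measurable.const_mul (Finset.measurable_sum _ fun i _ => ?_) _
    exact (((measurable_pi_apply i).comp (hg n)).mono (ℱ.mono n.le_succ) le_rfl).mul
      (hZ.measurable_innovation n i)
  · rw [abs_mul, abs_of_pos (hr.mem_Ioo n).1]
    refine mul_le_mul_of_nonneg_left ?_ (hr.mem_Ioo n).1.le
    calc |∑ i, g n ω i * innovation A Z Y n ω i|
        ≤ ∑ i, |g n ω i * innovation A Z Y n ω i| := Finset.abs_sum_le_sum_abs _ _
      _ ≤ ∑ _i : Fin N, C := Finset.sum_le_sum fun i _ => by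
          rw [abs_mul]
          exact (mul_le_of_le_one_right (abs_nonneg _)
            (hZ.abs_innovation_le hr hA n ω i)).trans (hC n ω i)
      _ = N * C := by simp
  · simp_rw [mul_pow]
    exact hr.sum_sq_lt_top.mul_right _
  · filter_upwards [condExp_smul (r n) (fun ω => ∑ i, g n ω i * innovation A Z Y n ω i) (ℱ n),
      hZ.condExp_sum_mul_innovation hr hA n (hg n) (hC n)] with ω h h0
    refine h.trans ?_
    rw [Pi.smul_apply, h0, Pi.zero_apply, smul_zero]

/-- The identity is exact: the increment of `x` is `r n * (Y - Z)`; in the cross term `Y - Z` splits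
into innovation and drift, while the square is kept whole. -/
lemma energy_succ (hZ : IsCompetitiveSystem μ ℱ A r Z Y)
    (hA : A ∈ Matrix.rowStochastic ℝ (Fin N)) {v : Fin N → ℝ} (hv : IsStationary A v) (n : ℕ)
    (ω : Ω) : energy v (centred Z (n + 1) ω) = energy v (centred Z n ω)
      - r n * dirichlet A v (centred Z n ω)
      + r n * ∑ i, 2 * v i * centred Z n ω i * innovation A Z Y n ω i
      + r n ^ 2 * ∑ i, v i * (Y (n + 1) ω i - Z n ω i) ^ 2 := by
  rw [dirichlet_eq hA hv]
  simp only [energy, Finset.mul_sum, ← Finset.sum_sub_distrib, ← Finset.sum_add_distrib]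
  refine Finset.sum_congr rfl fun i _ => ?_
  rw [show Y (n + 1) ω i - Z n ω i = innovation A Z Y n ω i
    - (centred Z n ω i - response A (centred Z n ω) i) by simp only [innovation, centred]; ring,
    hZ.centred_succ]
  ring

lemma ae_tendsto_energy [IsProbabilityMeasure μ] (hZ : IsCompetitiveSystem μ ℱ A r Z Y)
    (hr : IsStepSequence r) (hA : A ∈ Matrix.rowStochastic ℝ (Fin N)) {v : Fin N → ℝ}
    (hv : IsStationary A v) :
    ∀ᵐ ω ∂μ, (∃ L, Tendsto (fun n => energy v (centred Z n ω)) atTop (𝓝 L)) ∧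
      Summable fun n => r n * dirichlet A v (centred Z n ω) := by
  have hv1 : ∀ i, v i ≤ 1 := fun i => by
    rw [← hv.sum_eq_one]
    exact Finset.single_le_sum (fun j _ => (hv.pos j).le) (Finset.mem_univ i)
  have hg : ∀ n, Measurable[ℱ n] fun ω i => 2 * v i * centred Z n ω i := fun n =>
    (@measurable_pi_iff _ _ _ (ℱ n) _ _).2 fun i =>
      ((measurable_pi_apply i).comp (hZ.measurable_centred n)).const_mul _
  filter_upwards [hZ.ae_exists_tendsto_sum_innovation hr hA (C := 1) hg fun n ω i => by
    rw [abs_mul, abs_mul, abs_two, abs_of_pos (hv.pos i)]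
    nlinarith [hZ.abs_centred_le hr n ω i, hv1 i, hv.pos i, abs_nonneg (centred Z n ω i)]]
    with ω hω
  refine tendsto_and_summable_of_recursion (r := r) (fun n => energy_nonneg hv _)
    (fun n => mul_nonneg (hr.mem_Ioo n).1.le (dirichlet_nonneg hA hv _)) hr.sum_sq_lt_top
    (fun n => mul_nonneg (sq_nonneg _) (Finset.sum_nonneg fun i _ =>
      mul_nonneg (hv.pos i).le (sq_nonneg (Y (n + 1) ω i - Z n ω i)))) (fun n => ?_) hω
    fun n => hZ.energy_succ hA hv n ω
  -- The error is at most `r n ^ 2` because `v` has total mass 1 and `Y`, `Z` lie in the unit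
  -- interval.
  refine mul_le_of_le_one_right (sq_nonneg _) ?_
  rw [← hv.sum_eq_one]
  refine Finset.sum_le_sum fun i _ => mul_le_of_le_one_right (hv.pos i).le ?_
  obtain ⟨h0, h1⟩ := hZ.state_mem hr n ω i
  rcases hZ.noise_mem n ω i with h | h <;> rw [h] <;> nlinarith

end IsCompetitiveSystem

/-- If the product weights of all `b : Fin N → Bool` whose image has signed mean different from `x`
vanish, then every factor is degenerate. -/
lemma eq_zero_or_eq_one_of_prod_eq_zero {N : ℕ} {v : Fin N → ℝ} (hv : ∀ i, v i ≠ 0)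
    (I : Set (Fin N)) {x : ℝ} {p : Fin N → ℝ}
    (h : ∀ b : Fin N → Bool, partMean v I (fun i => cond (b i) 1 0 - 1 / 2) ≠ x →
      ∏ i, cond (b i) (p i) (1 - p i) = 0) (i : Fin N) : p i = 0 ∨ p i = 1 := by
  classical
  by_contra! hi
  -- This choice makes every factor nonzero except possibly the `i`-th. If `p i` is neither 0 nor 1,
  -- both values at `i` give a nonzero product, yet their signed means differ by `v i` up to sign.
  set b₀ : Fin N → Bool := fun j => decide (p j ≠ 0)
  have hmean : ∀ c : Bool,
      partMean v I (fun j => cond (Function.update b₀ i c j) 1 0 - 1 / 2) = x := by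
    intro c
    by_contra hne
    obtain ⟨j, -, hj⟩ := Finset.prod_eq_zero_iff.1 (h _ hne)
    by_cases hji : j = i
    · subst hji
      rw [Function.update_self] at hj
      cases c
      · exact hi.2 (sub_eq_zero.1 hj).symm
      · exact hi.1 hj
    · rw [Function.update_of_ne hji] at hj
      by_cases hpj : p j = 0 <;> simp [b₀, hpj] at hj
  have hdiff := (hmean true).trans (hmean false).symm
  rw [← sub_eq_zero, partMean, partMean, ← Finset.sum_sub_distrib,
    Finset.sum_eq_single_of_mem i (Finset.mem_univ i)
      fun j _ hj => by rw [Function.update_of_ne hj, Function.update_of_ne hj, sub_self]] at hdiff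
  simp only [Function.update_self, cond_true, cond_false] at hdiff
  exact mul_ne_zero (hv i) (partSign_ne_zero I i) (by linarith)

/-! ### Almost sure convergence in the two cases -/

namespace IsCompetitiveSystem

variable {Ω : Type*} {mΩ : MeasurableSpace Ω} {μ : Measure Ω}
  {ℱ : Filtration ℕ mΩ} {N : ℕ} {A : Matrix (Fin N) (Fin N) ℝ} {r : ℕ → ℝ}
  {Z Y : ℕ → Ω → Fin N → ℝ}

lemma ae_tendsto_centred_of_not_isBipartite [IsProbabilityMeasure μ]
    (hZ : IsCompetitiveSystem μ ℱ A r Z Y) (hr : IsStepSequence r)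
    (hA : A ∈ Matrix.rowStochastic ℝ (Fin N)) (hG : IsIrreducible (interactionGraph A))
    {v : Fin N → ℝ} (hv : IsStationary A v) (hb : ¬ IsBipartite (interactionGraph A)) :
    ∀ᵐ ω ∂μ, ∀ i, Tendsto (fun n => centred Z n ω i) atTop (𝓝 0) := by
  filter_upwards [hZ.ae_tendsto_energy hr hA hv] with ω ⟨⟨L, hL⟩, hS⟩
  obtain ⟨y, hy, φ, hφ, hlim⟩ := exists_subseq_dirichlet_eq_zero hA hv hr one_half_pos.le
    (fun n i => hZ.abs_centred_le hr n ω i) hS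
  obtain rfl := eq_zero_of_dirichlet_eq_zero hA hG hb hv hy
  -- The energy converges along the whole sequence, so the subsequence determines its limit.
  have hL0 : L = 0 := by
    have := tendsto_nhds_unique (hL.comp hφ.tendsto_atTop)
      (((continuous_energy v).tendsto 0).comp hlim)
    rw [this]
    simp [energy]
  rw [hL0] at hL
  exact tendsto_zero_of_energy hv hL

lemma partMean_centred_succ (hZ : IsCompetitiveSystem μ ℱ A r Z Y) {I J : Set (Fin N)}
    (hIJ : IsBipartition (interactionGraph A) I J) {v : Fin N → ℝ} (hv : IsStationary A v) (n : ℕ)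
    (ω : Ω) : partMean v I (centred Z (n + 1) ω) = partMean v I (centred Z n ω)
      + r n * ∑ i, v i * partSign I i * innovation A Z Y n ω i := by
  have h : partMean v I (centred Z (n + 1) ω) = partMean v I (centred Z n ω)
      - r n * (partMean v I (centred Z n ω) - partMean v I (response A (centred Z n ω)))
      + r n * ∑ i, v i * partSign I i * innovation A Z Y n ω i := by
    simp only [partMean, Finset.mul_sum, ← Finset.sum_sub_distrib, ← Finset.sum_add_distrib]
    exact Finset.sum_congr rfl fun i _ => by rw [hZ.centred_succ]; ring
  rw [h, hIJ.partMean_response hv]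
  ring

lemma abs_weight_le {I : Set (Fin N)} {v : Fin N → ℝ} (hv : IsStationary A v) (i : Fin N) :
    |v i * partSign I i| ≤ 1 := by
  have hs : |partSign I i| = 1 := by
    unfold partSign; split_ifs <;> simp
  rw [abs_mul, hs, mul_one, abs_of_pos (hv.pos i), ← hv.sum_eq_one]
  exact Finset.single_le_sum (fun j _ => (hv.pos j).le) (Finset.mem_univ i)

/-- The subsequential limit is `m` times the sign vector, with energy `m ^ 2`. Since energy and
signed mean converge along the full sequence, the variance about the signed mean tends to 0. -/
lemma ae_tendsto_centred_of_isBipartition [IsProbabilityMeasure μ]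
    (hZ : IsCompetitiveSystem μ ℱ A r Z Y) (hr : IsStepSequence r)
    (hA : A ∈ Matrix.rowStochastic ℝ (Fin N)) (hG : IsIrreducible (interactionGraph A))
    {v : Fin N → ℝ} (hv : IsStationary A v) {I J : Set (Fin N)}
    (hIJ : IsBipartition (interactionGraph A) I J) :
    ∀ᵐ ω ∂μ, ∃ m, ∀ i, Tendsto (fun n => centred Z n ω i) atTop (𝓝 (m * partSign I i)) := by
  filter_upwards [hZ.ae_tendsto_energy hr hA hv,
    hZ.ae_exists_tendsto_sum_innovation hr hA (g := fun _ _ i => v i * partSign I i)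
      (fun _ => measurable_const) (fun _ _ i => abs_weight_le hv i)] with ω ⟨⟨L, hL⟩, hS⟩ ⟨l, hl⟩
  obtain ⟨y, hy, φ, hφ, hlim⟩ := exists_subseq_dirichlet_eq_zero hA hv hr one_half_pos.le
    (fun n i => hZ.abs_centred_le hr n ω i) hS
  have hsum : ∀ n, partMean v I (centred Z 0 ω) + ∑ k ∈ Finset.range n,
      r k * ∑ i, v i * partSign I i * innovation A Z Y k ω i = partMean v I (centred Z n ω) := by
    intro n
    induction n with
    | zero => simp
    | succ n ih => rw [hZ.partMean_centred_succ hIJ hv, ← ih, Finset.sum_range_succ, add_assoc]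
  obtain ⟨m, hm⟩ : ∃ m, Tendsto (fun n => partMean v I (centred Z n ω)) atTop (𝓝 m) :=
    ⟨_, (hl.const_add (partMean v I (centred Z 0 ω))).congr hsum⟩
  have hmy : m = partMean v I y := tendsto_nhds_unique (hm.comp hφ.tendsto_atTop)
    (((continuous_partMean v I).tendsto y).comp hlim)
  have hLm : L = m ^ 2 := by
    have h1 : L = energy v y := tendsto_nhds_unique (hL.comp hφ.tendsto_atTop)
      (((continuous_energy v).tendsto y).comp hlim)
    have h2 := energy_sub_mul_partSign I hv y
    have h3 : (fun i => y i - partMean v I y * partSign I i) = 0 := by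
      funext i
      exact sub_eq_zero.2 (hIJ.eq_mul_partSign_of_dirichlet_eq_zero hA hG hv hy i)
    rw [h3, show energy v 0 = 0 by simp [energy], ← hmy, ← h1] at h2
    linarith
  have hE : Tendsto (fun n => energy v fun i => centred Z n ω i
      - partMean v I (centred Z n ω) * partSign I i) atTop (𝓝 0) := by
    simp_rw [energy_sub_mul_partSign I hv]
    have := hL.sub (hm.pow 2)
    rwa [hLm, sub_self] at this
  refine ⟨m, fun i => ?_⟩
  have := (tendsto_zero_of_energy hv hE i).add (hm.mul_const (partSign I i))
  simpa using this

lemma martingale_partMean_centred [IsProbabilityMeasure μ]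
    (hZ : IsCompetitiveSystem μ ℱ A r Z Y) (hr : IsStepSequence r)
    (hA : A ∈ Matrix.rowStochastic ℝ (Fin N)) {v : Fin N → ℝ} (hv : IsStationary A v)
    {I J : Set (Fin N)} (hIJ : IsBipartition (interactionGraph A) I J) :
    Martingale (fun n ω => partMean v I (centred Z n ω)) ℱ μ := by
  have hmeas : ∀ n, Measurable[ℱ n] fun ω => partMean v I (centred Z n ω) := fun n =>
    (continuous_partMean v I).measurable.comp (hZ.measurable_centred n)
  refine martingale_of_condExp_sub_eq_zero_nat (fun n => (hmeas n).stronglyMeasurable)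
    (fun n => ?_) fun n => ?_
  · refine Integrable.of_bound ((hmeas n).mono (ℱ.le n) le_rfl).aestronglyMeasurable
      (∑ _i : Fin N, (1 / 2 : ℝ)) (ae_of_all _ fun ω => ?_)
    refine (Finset.abs_sum_le_sum_abs _ _).trans (Finset.sum_le_sum fun i _ => ?_)
    rw [← mul_assoc, abs_mul]
    exact (mul_le_of_le_one_left (abs_nonneg _) (abs_weight_le hv i)).trans
      (hZ.abs_centred_le hr n ω i)
  · have hdiff : (fun ω => partMean v I (centred Z (n + 1) ω))
        - (fun ω => partMean v I (centred Z n ω))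
        = r n • fun ω => ∑ i, v i * partSign I i * innovation A Z Y n ω i := by
      funext ω
      simp only [Pi.sub_apply, Pi.smul_apply, smul_eq_mul]
      rw [hZ.partMean_centred_succ hIJ hv]
      ring
    change μ[(fun ω => partMean v I (centred Z (n + 1) ω))
        - (fun ω => partMean v I (centred Z n ω)) | ℱ n] =ᵐ[μ] 0
    rw [hdiff]
    filter_upwards [condExp_smul (r n)
      (fun ω => ∑ i, v i * partSign I i * innovation A Z Y n ω i) (ℱ n),
      hZ.condExp_sum_mul_innovation hr hA n (g := fun _ i => v i * partSign I i)
        measurable_const (fun _ i => abs_weight_le hv i)] with ω h h0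
    rw [h, Pi.smul_apply, h0, Pi.zero_apply, smul_zero]

end IsCompetitiveSystem

/-! ### Nondegeneracy of the limit under conditional independence -/

namespace IsCompetitiveSystem

variable {Ω : Type*} {mΩ : MeasurableSpace Ω} {μ : Measure Ω}
  {ℱ : Filtration ℕ mΩ} {N : ℕ} {A : Matrix (Fin N) (Fin N) ℝ} {r : ℕ → ℝ}
  {Z Y : ℕ → Ω → Fin N → ℝ}

/-- The new signed mean is a convex combination of the old one and that of the actions, with
positive weight `r n` on the latter. -/
lemma partMean_noise_eq (hZ : IsCompetitiveSystem μ ℱ A r Z Y) (hr : IsStepSequence r)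
    {v : Fin N → ℝ} {I : Set (Fin N)} {x : ℝ} {n : ℕ} {ω : Ω}
    (h0 : partMean v I (centred Z n ω) = x) (h1 : partMean v I (centred Z (n + 1) ω) = x) :
    partMean v I (fun i => Y (n + 1) ω i - 1 / 2) = x := by
  have h : partMean v I (centred Z (n + 1) ω) = (1 - r n) * partMean v I (centred Z n ω)
      + r n * partMean v I (fun i => Y (n + 1) ω i - 1 / 2) := by
    simp only [partMean, Finset.mul_sum, ← Finset.sum_add_distrib]
    exact Finset.sum_congr rfl fun i _ => by simp only [centred, hZ.step]; ring
  rw [h0, h1] at h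
  refine mul_left_cancel₀ (hr.mem_Ioo n).1.ne' ?_
  linarith

/-- If both the current and the next state are extreme, then every agent repeats its state. -/
lemma noise_eq_state (hZ : IsCompetitiveSystem μ ℱ A r Z Y) (hr : IsStepSequence r) {n : ℕ}
    {ω : Ω} {i : Fin N} (h0 : |centred Z n ω i| = 1 / 2)
    (h1 : |centred Z (n + 1) ω i| = 1 / 2) : Y (n + 1) ω i = Z n ω i := by
  obtain ⟨hr0, hr1⟩ := hr.mem_Ioo n
  rw [centred] at h0 h1
  rw [hZ.step] at h1
  have hz : Z n ω i = 0 ∨ Z n ω i = 1 := by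
    rcases (abs_eq one_half_pos.le).1 h0 with h | h
    · right; linarith
    · left; linarith
  rcases hz with hz | hz <;> rcases hZ.noise_mem n ω i with hy | hy <;> rw [hz, hy] at h1 ⊢ <;>
    rcases (abs_eq one_half_pos.le).1 h1 with h | h <;> linarith

variable [IsProbabilityMeasure μ]

lemma condProb_eq_zero (hZ : IsCompetitiveSystem μ ℱ A r Z Y)
    (hA : A ∈ Matrix.rowStochastic ℝ (Fin N)) (n : ℕ) (i : Fin N) :
    μ⟦{ω | Y (n + 1) ω i = 0} | ℱ n⟧ =ᵐ[μ]
      fun ω => 1 - (1 / 2 + response A (centred Z n ω) i) := by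
  have h1 : ({ω | Y (n + 1) ω i = 0}.indicator fun _ => (1 : ℝ))
      = (fun _ => (1 : ℝ)) - fun ω => Y (n + 1) ω i := by
    funext ω
    rcases hZ.noise_mem n ω i with h | h <;> simp [Set.indicator, h]
  rw [h1]
  have h2 := hZ.condProb_eq hA n i
  rw [hZ.indicator_noise] at h2
  filter_upwards [condExp_sub (integrable_const (1 : ℝ)) (hZ.integrable_noise n i) (ℱ n), h2]
    with ω h h3
  rw [h, Pi.sub_apply, h3, condExp_const (ℱ.le n)]

/-- If the signed mean of the next actions is almost surely constant, then conditionally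
independent actions are deterministic given the past. -/
lemma ae_abs_response_eq_half (hZ : IsCompetitiveSystem μ ℱ A r Z Y)
    (hA : A ∈ Matrix.rowStochastic ℝ (Fin N)) {v : Fin N → ℝ} (hv : IsStationary A v)
    (I : Set (Fin N)) (hY : CondIndepNoise μ ℱ Y) {x : ℝ} {n : ℕ}
    (hx : ∀ᵐ ω ∂μ, partMean v I (fun i => Y (n + 1) ω i - 1 / 2) = x) :
    ∀ᵐ ω ∂μ, ∀ i, |response A (centred Z n ω) i| = 1 / 2 := by
  -- An action profile with signed mean other than `x` has probability 0, and conditional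
  -- independence factorizes its conditional probability.
  have hprod : ∀ᵐ ω ∂μ, ∀ b : Fin N → Bool,
      partMean v I (fun i => cond (b i) 1 0 - 1 / 2) ≠ x →
      ∏ i, (μ⟦{ω' | Y (n + 1) ω' i = cond (b i) 1 0} | ℱ n⟧) ω = 0 := by
    refine ae_all_iff.2 fun b => ?_
    by_cases hb : partMean v I (fun i => cond (b i) 1 0 - 1 / 2) = x
    · exact ae_of_all _ fun _ h => absurd hb h
    · have hnull : ({ω | ∀ i, Y (n + 1) ω i = cond (b i) 1 0}.indicator fun _ => (1 : ℝ))
          =ᵐ[μ] fun _ => 0 := by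
        filter_upwards [hx] with ω hω
        refine Set.indicator_of_notMem (fun h => hb ?_) _
        rw [← hω]
        congr 1
        funext i
        rw [h i]
      have h0 := condExp_congr_ae (m := ℱ n) hnull
      rw [condExp_const (ℱ.le n)] at h0
      filter_upwards [h0, hY n fun i => cond (b i) 1 0] with ω h1 h2 _
      rw [← h2, h1]
  filter_upwards [hprod, ae_all_iff.2 fun i => hZ.condProb_eq hA n i,
    ae_all_iff.2 fun i => hZ.condProb_eq_zero hA n i] with ω h h1 h0 i
  have hdeg := eq_zero_or_eq_one_of_prod_eq_zero (fun j => (hv.pos j).ne') I (x := x)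
    (p := fun j => 1 / 2 + response A (centred Z n ω) j) (fun b hb => by
      rw [← h b hb]
      refine Finset.prod_congr rfl fun j _ => ?_
      cases b j
      · exact (h0 j).symm
      · exact (h1 j).symm) i
  rcases hdeg with h2 | h2
  · rw [show response A (centred Z n ω) i = -(1 / 2) by linarith, abs_neg]
    norm_num
  · rw [show response A (centred Z n ω) i = 1 / 2 by linarith]
    norm_num

/-- If the signed mean of the states converges almost surely to a constant, then conditionally
independent actions force the initial state to be one of the two frozen configurations. -/
lemma frozen_of_tendsto_const (hZ : IsCompetitiveSystem μ ℱ A r Z Y) (hr : IsStepSequence r)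
    (hA : A ∈ Matrix.rowStochastic ℝ (Fin N)) (hN : 1 ≤ N)
    (hG : IsIrreducible (interactionGraph A))
    {v : Fin N → ℝ} (hv : IsStationary A v) {I J : Set (Fin N)}
    (hIJ : IsBipartition (interactionGraph A) I J) (hY : CondIndepNoise μ ℱ Y) {x : ℝ}
    (hx : ∀ᵐ ω ∂μ, Tendsto (fun n => partMean v I (centred Z n ω)) atTop (𝓝 x)) :
    ¬ NotFrozenAtStart μ I J (Z 0) := by
  have hmean : ∀ n, ∀ᵐ ω ∂μ, partMean v I (centred Z n ω) = x := fun n =>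
    ae_eq_const_of_tendsto (hZ.martingale_partMean_centred hr hA hv hIJ)
      (C := ∑ _i : Fin N, (1 / 2 : ℝ)) (fun n ω => by
        refine (Finset.abs_sum_le_sum_abs _ _).trans (Finset.sum_le_sum fun i _ => ?_)
        rw [← mul_assoc, abs_mul]
        exact (mul_le_of_le_one_left (abs_nonneg _) (abs_weight_le hv i)).trans
          (hZ.abs_centred_le hr n ω i)) hx n
  have hext : ∀ n, ∀ᵐ ω ∂μ, ∀ i, |centred Z n ω i| = 1 / 2 := by
    intro n
    filter_upwards [hZ.ae_abs_response_eq_half hA hv I hY (n := n) (x := x) (by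
      filter_upwards [hmean n, hmean (n + 1)] with ω h0 h1
      exact hZ.partMean_noise_eq hr h0 h1)] with ω h j
    -- Some agent `i` listens to `j`; its response is extreme only if `j` is extreme.
    obtain ⟨i, hij⟩ := hv.exists_ne_zero j
    exact abs_eq_of_abs_response_eq hA (fun k => hZ.abs_centred_le hr n ω k) (h i) hij
  -- The first action coincides with the initial state, hence equals its own conditional mean given
  -- `ℱ 0`.
  have hfix : ∀ᵐ ω ∂μ, ∀ i, response A (centred Z 0 ω) i = centred Z 0 ω i := by
    refine ae_all_iff.2 fun i => ?_
    have hYZ : (fun ω => Y (0 + 1) ω i) =ᵐ[μ] fun ω => Z 0 ω i := by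
      filter_upwards [hext 0, hext 1] with ω h0 h1
      exact hZ.noise_eq_state hr (h0 i) (h1 i)
    have hZm : Measurable[ℱ 0] fun ω => Z 0 ω i :=
      (measurable_pi_apply i).comp (hZ.measurable_state 0)
    have h1 := condExp_congr_ae (m := ℱ 0) hYZ
    rw [condExp_of_stronglyMeasurable (ℱ.le 0) hZm.stronglyMeasurable
      ((integrable_congr hYZ).1 (hZ.integrable_noise 0 i)), ← hZ.indicator_noise] at h1
    filter_upwards [h1, hZ.condProb_eq hA 0 i] with ω h2 h3
    rw [h3] at h2
    rw [centred]
    linarith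
  have hform : ∀ᵐ ω ∂μ, ∀ i, centred Z 0 ω i = x * partSign I i := by
    filter_upwards [hfix, hmean 0] with ω h h0 i
    have hd : dirichlet A v (centred Z 0 ω) = 0 := by
      rw [dirichlet_eq hA hv]
      simp [h]
    rw [hIJ.eq_mul_partSign_of_dirichlet_eq_zero hA hG hv hd i, h0]
  have habs : |x| = 1 / 2 := by
    obtain ⟨ω, h1, h2⟩ := (hform.and (hext 0)).exists
    have h3 := h2 ⟨0, hN⟩
    rw [h1, abs_mul] at h3
    rw [← h3]
    unfold partSign
    split_ifs <;> simp
  rintro ⟨hf1, hf0⟩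
  rcases (abs_eq one_half_pos.le).1 habs with h | h
  · refine hf1 ?_
    filter_upwards [hform] with ω hω
    refine ⟨fun i hi => ?_, fun i hi => ?_⟩ <;> have h1 := hω i <;> rw [centred, h] at h1
    · rw [partSign_of_mem hi] at h1; linarith
    · rw [hIJ.partSign_right hi] at h1; linarith
  · refine hf0 ?_
    filter_upwards [hform] with ω hω
    refine ⟨fun i hi => ?_, fun i hi => ?_⟩ <;> have h1 := hω i <;> rw [centred, h] at h1
    · rw [partSign_of_mem hi] at h1; linarith
    · rw [hIJ.partSign_right hi] at h1; linarith

end IsCompetitiveSystem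

end Competitive

theorem theorem2p1 {Ω : Type*} {mΩ : MeasurableSpace Ω} (μ : Measure Ω) [IsProbabilityMeasure μ]
    (ℱ : Filtration ℕ mΩ) (N : ℕ) (hN : 1 ≤ N) (A : Matrix (Fin N) (Fin N) ℝ)
    (hA : A ∈ Matrix.rowStochastic ℝ (Fin N)) (r : ℕ → ℝ) (hr : Competitive.IsStepSequence r)
    (Z Y : ℕ → Ω → Fin N → ℝ) (hZ : Competitive.IsCompetitiveSystem μ ℱ A r Z Y)
    (hG : Competitive.IsIrreducible (Competitive.interactionGraph A)) :
    ∃ Zlim : Ω → Fin N → ℝ, Measurable Zlim ∧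
      (∀ᵐ ω ∂μ, Tendsto (fun n => Z n ω) atTop (𝓝 (Zlim ω))) ∧
      (∀ I J : Set (Fin N), Competitive.IsBipartition (Competitive.interactionGraph A) I J →
        ∃ Zinf : Ω → ℝ, Measurable Zinf ∧
          (∀ᵐ ω ∂μ, (∀ i ∈ I, Zlim ω i = Zinf ω) ∧ (∀ i ∈ J, Zlim ω i = 1 - Zinf ω)) ∧
          (Competitive.CondIndepNoise μ ℱ Y → Competitive.NotFrozenAtStart μ I J (Z 0) →
            ∀ x : ℝ, μ {ω | Zinf ω = x} < 1)) ∧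
      (¬ Competitive.IsBipartite (Competitive.interactionGraph A) →
        ∀ᵐ ω ∂μ, ∀ i, Zlim ω i = 1 / 2) := by
  open Competitive in
  obtain ⟨v, hv⟩ := exists_isStationary hN hA hG
  have hadd : ∀ {ω : Ω} {c : Fin N → ℝ},
      (∀ i, Tendsto (fun n => centred Z n ω i) atTop (𝓝 (c i))) →
      Tendsto (fun n => Z n ω) atTop (𝓝 fun i => c i + 1 / 2) := fun {ω c} h => by
    refine tendsto_pi_nhds.2 fun i => ?_
    simpa [centred] using (h i).add_const (1 / 2 : ℝ)
  have hex : ∀ᵐ ω ∂μ, ∃ z, Tendsto (fun n => Z n ω) atTop (𝓝 z) := by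
    by_cases hb : IsBipartite (interactionGraph A)
    · obtain ⟨I, J, hIJ⟩ := hb
      filter_upwards [hZ.ae_tendsto_centred_of_isBipartition hr hA hG hv hIJ] with ω ⟨m, hm⟩
      exact ⟨_, hadd hm⟩
    · filter_upwards [hZ.ae_tendsto_centred_of_not_isBipartite hr hA hG hv hb] with ω h
      exact ⟨_, hadd h⟩
  obtain ⟨Zlim, hmeas, hlim⟩ := measurable_limit_of_tendsto_metrizable_ae
    (fun n => ((hZ.measurable_state n).mono (ℱ.le n) le_rfl).aemeasurable) hex
  refine ⟨Zlim, hmeas, hlim, fun I J hIJ => ?_, fun hb => ?_⟩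
  · have hcent : Continuous fun z : Fin N → ℝ => partMean v I fun i => z i - 1 / 2 :=
      (continuous_partMean v I).comp (by fun_prop)
    -- Reading the common value off the signed mean of `Zlim` gives measurability and works even if
    -- a part is empty.
    refine ⟨fun ω => 1 / 2 + partMean v I fun i => Zlim ω i - 1 / 2,
      (hcent.measurable.comp hmeas).const_add _, ?_, fun hY hZ0 x => ?_⟩
    · filter_upwards [hlim, hZ.ae_tendsto_centred_of_isBipartition hr hA hG hv hIJ]
        with ω h ⟨m, hm⟩
      have hz := tendsto_nhds_unique h (hadd hm)
      have hpm : (partMean v I fun i => Zlim ω i - 1 / 2) = m := by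
        rw [hz]
        have h1 : ∀ j, v j * (partSign I j * (m * partSign I j + 1 / 2 - 1 / 2)) = v j * m :=
          fun j => by linear_combination (v j * m) * partSign_mul_self I j
        simp only [partMean, h1]
        rw [← Finset.sum_mul, hv.sum_eq_one, one_mul]
      rw [hpm]
      refine ⟨fun i hi => ?_, fun i hi => ?_⟩ <;> rw [hz]
      · simp only [partSign_of_mem hi]; ring
      · simp only [hIJ.partSign_right hi]; ring
    · refine lt_of_le_of_ne prob_le_one fun h1 => ?_
      have hms : MeasurableSet {ω | (1 / 2 + partMean v I fun i => Zlim ω i - 1 / 2) = x} :=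
        measurableSet_eq_fun ((hcent.measurable.comp hmeas).const_add _) measurable_const
      have hae : ∀ᵐ ω ∂μ, (1 / 2 + partMean v I fun i => Zlim ω i - 1 / 2) = x :=
        (prob_compl_eq_zero_iff hms).2 h1
      refine hZ.frozen_of_tendsto_const hr hA hN hG hv hIJ hY (x := x - 1 / 2) ?_ hZ0
      filter_upwards [hlim, hae] with ω h h2
      rw [← h2, add_sub_cancel_left]
      exact (hcent.tendsto (Zlim ω)).comp h
  · filter_upwards [hlim, hZ.ae_tendsto_centred_of_not_isBipartite hr hA hG hv hb] with ω h h0 i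
    rw [tendsto_nhds_unique h (hadd h0), zero_add]
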